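/- For a finite connected simple undirected graph $G$ with path metric $d_G$, and integers $k,\ell\ge 0$, let $\mathrm{EMC}_{k,\ell}(G;\mathbb{Z})$ be the free abelian group on the tuples $(x_0,\dots,x_k)$ of pairwise distinct vertices of $G$ of length $\sum_{i=0}^{k-1} d_G(x_i,x_{i+1})=\ell$. Let $\partial\colon \mathrm{EMC}_{k,\ell}(G;\mathbb{Z})\to\mathrm{EMC}_{k-1,\ell}(G;\mathbb{Z})$ be the differential $\partial=\sum_{i=1}^{k-1}(-1)^i\partial_i$, where $\partial_i(x_0,\dots,x_k)=(x_0,\dots,x_{i-1},x_{i+1},\dots,x_k)$ if this tuple still has length $\ell$, and $\partial_i(x_0,\dots,x_k)=0$ otherwise. The integral eulerian magnitude homology of $G$ is the bigraded abelian group \[ \mathrm{EMH}(G;\mathbb{Z})=\bigoplus_{k,\ell\ge 0}\mathrm{EMH}_{k,\ell}(G;\mathbb{Z}),\qquad \mathrm{EMH}_{k,\ell}(G;\mathbb{Z})=H_k(\mathrm{EMC}_{*,\ell}(G;\mathbb{Z}),\partial). \] Proposition. Let $A$ be any finitely generated abelian group. Then there exists a finite connected simple undirected graph $G$ whose integral eulerian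 magnitude homology $\mathrm{EMH}(G;\mathbb{Z})$ contains a subgroup isomorphic to $A$. -/

import Mathlib

noncomputable section

open scoped DirectSum

namespace EulerianMagnitude

universe u v

set_option linter.unusedSimpArgs false

variable {V : Type*}

/-- The length `∑ d_G(x_i, x_{i+1})` of a tuple `(x_0, …, x_k)` for the path metric of `G`, with
value `⊤` when two consecutive vertices are not joined by a path. -/
def len (G : SimpleGraph V) {k : ℕ} (x : Fin (k + 1) → V) : ℕ∞ :=
  ∑ i : Fin k, G.edist (x i.castSucc) (x i.succ)

/-- The generators of `EMC_{k,l}(G)`: tuples `(x_0, …, x_k)` of pairwise distinct vertices, of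
(finite) length `l`. -/
abbrev Generator (G : SimpleGraph V) (k l : ℕ) : Type _ :=
  {x : Fin (k + 1) → V // Function.Injective x ∧ len G x = (l : ℕ∞)}

/-- The eulerian magnitude chains `EMC_{k,l}(G; R)`: the free `R`-module on the generators. -/
abbrev EMC (R : Type*) [CommRing R] (G : SimpleGraph V) (k l : ℕ) : Type _ :=
  Generator G k l →₀ R

/-- The inner positions `1, …, k` among the positions `0, …, k + 1` of a `(k + 2)`-tuple. -/
def innerPos {k : ℕ} (j : Fin k) : Fin (k + 2) := j.succ.castSucc

/-- The tuple with the entry at the inner position `j + 1` deleted. -/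
def del {k : ℕ} (j : Fin k) (x : Fin (k + 2) → V) : Fin (k + 1) → V :=
  fun i => x ((innerPos j).succAbove i)

theorem del_injective {k : ℕ} (j : Fin k) {x : Fin (k + 2) → V} (hx : Function.Injective x) :
    Function.Injective (del j x) :=
  hx.comp Fin.succAbove_right_injective

open Classical in
/-- The face of a generator at the inner position `j + 1`: delete the entry if the length is
preserved, and `0` otherwise. -/
def faceGen (R : Type*) [CommRing R] (G : SimpleGraph V) {k l : ℕ} (j : Fin k)
    (x : Generator G (k + 1) l) : EMC R G k l :=
  if h : len G (del j x.1) = (l : ℕ∞) then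
    Finsupp.single ⟨del j x.1, del_injective j x.2.1, h⟩ 1
  else 0

/-- The face map on chains, extended linearly. -/
def face (R : Type*) [CommRing R] (G : SimpleGraph V) {k l : ℕ} (j : Fin k) :
    EMC R G (k + 1) l →ₗ[R] EMC R G k l :=
  Finsupp.linearCombination R (faceGen R G j)

/-- The differential `EMC_{k+1,l} → EMC_{k,l}`, `∂ = ∑_{i=1}^{k} (-1)^i ∂_i`, where `i = j + 1`. -/
def d (R : Type*) [CommRing R] (G : SimpleGraph V) (k l : ℕ) :
    EMC R G (k + 1) l →ₗ[R] EMC R G k l :=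
  ∑ j : Fin k, (-1 : R) ^ ((j : ℕ) + 1) • face R G j

theorem val_succAbove {n : ℕ} (p : Fin (n + 1)) (i : Fin n) :
    (p.succAbove i : ℕ) = if (i : ℕ) < p then (i : ℕ) else i + 1 := by
  simp only [Fin.succAbove, Fin.lt_def, Fin.val_castSucc]
  split_ifs <;> simp

theorem val_predAbove {n : ℕ} (p : Fin n) (i : Fin (n + 1)) :
    (p.predAbove i : ℕ) = if (p : ℕ) < i then (i : ℕ) - 1 else i := by
  by_cases h : (p : ℕ) < i
  · rw [if_pos h, Fin.predAbove_of_castSucc_lt p i h, Fin.val_pred]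
  · rw [if_neg h, Fin.predAbove_of_le_castSucc p i (not_lt.1 h), Fin.coe_castPred]

theorem val_innerPos {k : ℕ} (j : Fin k) : (innerPos j : ℕ) = j + 1 := rfl

/-- Deleting an inner entry does not increase the length. -/
theorem len_del_le (G : SimpleGraph V) {k : ℕ} (j : Fin k) (x : Fin (k + 2) → V) :
    len G (del j x) ≤ len G x := by
  have key : ∀ i : Fin k, G.edist (del j x i.castSucc) (del j x i.succ) ≤
      (if i = j then G.edist (x j.castSucc.castSucc) (x j.castSucc.succ) else 0) +
        G.edist (x (j.castSucc.succAbove i).castSucc) (x (j.castSucc.succAbove i).succ) := by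
    intro i
    rcases lt_trichotomy i j with h | h | h
    · have e1 : (innerPos j).succAbove i.castSucc = (j.castSucc.succAbove i).castSucc := by
        rw [Fin.lt_def] at h; ext; simp only [val_succAbove, val_innerPos, Fin.val_castSucc, Fin.val_succ]; grind
      have e2 : (innerPos j).succAbove i.succ = (j.castSucc.succAbove i).succ := by
        rw [Fin.lt_def] at h; ext; simp only [val_succAbove, val_innerPos, Fin.val_castSucc, Fin.val_succ]; grind
      simp [del, e1, e2]
    · subst h
      have e1 : (innerPos i).succAbove i.castSucc = i.castSucc.castSucc := by
        ext; simp only [val_succAbove, val_innerPos, Fin.val_castSucc, Fin.val_succ]; grind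
      have e2 : (innerPos i).succAbove i.succ = (i.castSucc.succAbove i).succ := by
        ext; simp only [val_succAbove, val_innerPos, Fin.val_castSucc, Fin.val_succ]; grind
      have e3 : (i.castSucc.succAbove i).castSucc = i.castSucc.succ := by
        ext; simp only [val_succAbove, val_innerPos, Fin.val_castSucc, Fin.val_succ]; grind
      simp only [del, e1, e2, e3, if_true]
      exact G.edist_triangle
    · have e1 : (innerPos j).succAbove i.castSucc = (j.castSucc.succAbove i).castSucc := by
        rw [Fin.lt_def] at h; ext; simp only [val_succAbove, val_innerPos, Fin.val_castSucc, Fin.val_succ]; grind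
      have e2 : (innerPos j).succAbove i.succ = (j.castSucc.succAbove i).succ := by
        rw [Fin.lt_def] at h; ext; simp only [val_succAbove, val_innerPos, Fin.val_castSucc, Fin.val_succ]; grind
      simp [del, e1, e2]
  calc len G (del j x) ≤ _ := Finset.sum_le_sum fun i _ => key i
    _ = len G x := by
      rw [Finset.sum_add_distrib, len, Fin.sum_univ_succAbove _ j.castSucc]
      simp

theorem innerPos_succAbove {k : ℕ} (i : Fin (k + 1)) (j : Fin k) :
    (innerPos i).succAbove (innerPos j) = innerPos (i.succAbove j) := by
  ext; simp only [val_succAbove, val_innerPos, Fin.val_castSucc, Fin.val_succ]; grind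

/-- Two inner entries can be deleted in either order. -/
theorem del_del {k : ℕ} (i : Fin (k + 1)) (j : Fin k) (x : Fin (k + 3) → V) :
    del (j.predAbove i) (del (i.succAbove j) x) = del j (del i x) := by
  funext a
  simp only [del]
  congr 1
  ext
  simp only [val_predAbove, val_succAbove, val_innerPos, Fin.val_castSucc, Fin.val_succ]
  grind

open Classical in
theorem face_faceGen (R : Type*) [CommRing R] (G : SimpleGraph V) {k l : ℕ} (i : Fin (k + 1))
    (j : Fin k) (x : Generator G (k + 2) l) :
    face R G j (faceGen R G i x) =
      if h : len G (del j (del i x.1)) = (l : ℕ∞) then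
        Finsupp.single ⟨del j (del i x.1), del_injective j (del_injective i x.2.1), h⟩ 1
      else 0 := by
  by_cases h1 : len G (del i x.1) = (l : ℕ∞)
  · rw [faceGen, dif_pos h1, face, Finsupp.linearCombination_single, one_smul, faceGen]
  · have h2 : ¬ len G (del j (del i x.1)) = (l : ℕ∞) := fun h2 =>
      h1 (le_antisymm ((len_del_le G i x.1).trans_eq x.2.2) (h2.symm.trans_le (len_del_le G j (del i x.1))))
    rw [faceGen, dif_neg h1, map_zero, dif_neg h2]

/-- The eulerian magnitude chains form a chain complex. -/
theorem d_comp_d (R : Type*) [CommRing R] (G : SimpleGraph V) (k l : ℕ) :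
    d R G k l ∘ₗ d R G (k + 1) l = 0 := by
  refine Finsupp.lhom_ext' fun x => LinearMap.ext_ring ?_
  have hx : ∀ i : Fin (k + 1), face R G i (Finsupp.single x 1) = faceGen R G i x := by
    intro i; simp [face]
  simp only [LinearMap.comp_apply, Finsupp.lsingle_apply, LinearMap.zero_apply, d,
    LinearMap.sum_apply, LinearMap.smul_apply, hx, map_sum, map_smul, Finset.smul_sum, smul_smul]
  rw [← Finset.sum_product']
  have hF : ∀ p : Fin (k + 1) × Fin k,
      face R G (p.2.predAbove p.1) (faceGen R G (p.1.succAbove p.2) x) =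
        face R G p.2 (faceGen R G p.1 x) := by
    rintro ⟨i, j⟩
    simp only [face_faceGen, del_del]
  have hs : ∀ p : Fin (k + 1) × Fin k,
      (-1 : R) ^ ((p.1.succAbove p.2 : ℕ) + 1) * (-1) ^ ((p.2.predAbove p.1 : ℕ) + 1) =
        -((-1) ^ ((p.1 : ℕ) + 1) * (-1) ^ ((p.2 : ℕ) + 1)) := by
    rintro ⟨i, j⟩
    have := Fin.neg_one_pow_succAbove_add_predAbove (R := R) i j
    rw [pow_add, pow_add] at this
    simp only [pow_succ]
    linear_combination this
  refine Finset.sum_involution (fun p _ => (p.1.succAbove p.2, p.2.predAbove p.1)) ?_ ?_ ?_ ?_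
  · intro p _
    simp only [hF, hs, neg_smul, add_neg_cancel]
  · rintro ⟨i, j⟩ _ _ h
    exact Fin.succAbove_ne i j (congrArg Prod.fst h)
  · simp
  · rintro ⟨i, j⟩ _
    ext <;> simp only [val_predAbove, val_succAbove] <;> grind

/-- The eulerian magnitude chain complex `EMC_{*,l}(G; R)`. -/
def complex (R : Type v) [CommRing R] {V : Type u} (G : SimpleGraph V) (l : ℕ) :
    ChainComplex (ModuleCat.{max u v} R) ℕ :=
  ChainComplex.of (fun k => ModuleCat.of R (EMC R G k l)) (fun k => ModuleCat.ofHom (d R G k l))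
    (fun k => by rw [← ModuleCat.ofHom_comp, d_comp_d]; rfl)

/-- The eulerian magnitude homology `EMH_{k,l}(G; R) = H_k(EMC_{*,l}(G; R))`. -/
abbrev EMH (R : Type v) [CommRing R] {V : Type u} (G : SimpleGraph V) (k l : ℕ) :
    ModuleCat.{max u v} R :=
  (complex R G l).homology k

/-- The bigraded eulerian magnitude homology `EMH(G; R) = ⨁_{k,l ≥ 0} EMH_{k,l}(G; R)`. -/
abbrev TotalEMH (R : Type v) [CommRing R] {V : Type u} (G : SimpleGraph V) : Type (max u v) :=
  ⨁ p : ℕ × ℕ, EMH R G p.1 p.2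

end EulerianMagnitude

end

/-! Write `A` as `ℤ^n × T` with `T` finite. The free part embeds in bidegree (0, 0), where the
homology is free on the vertices; the torsion is found in bidegree (3, 4).

For a finite group `B`, the join of three copies of `B` is simply connected and `B` acts freely on
it, so the quotient complex has H₁ = `B`. Take the Hasse diagram of its face poset with a bottom and
a top added. Since rank changes by at most one along an edge, tuples of length 4 from bottom to top
are geodesics, and all their faces keep length 4. They span a subcomplex which is the simplicial
chain complex of the barycentric subdivision, shifted by 2. Thus H₁ appears in bidegree (3, 4).

No topology is invoked: explicit loops are additive modulo boundaries (`loopChain_add_mem`), and an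
explicit `B`-valued cocycle recovers `g` from the loop of `g` (`chainCocycle_d`,
`chainCocycle_edgeChain`). By `exists_injective_to_homology` this embeds `B`. -/

noncomputable section

namespace EulerianMagnitude

open CategoryTheory

/-! ### Detecting a group inside homology -/

/-- Cycles map to homology, and a cocycle descends to homology. -/
theorem exists_homology_maps {R : Type} [CommRing R] {ι : Type*} {c : ComplexShape ι}
    (K : HomologicalComplex (ModuleCat.{0} R) c) (k : ι) {N : Type} [AddCommGroup N] [Module R N]
    (ψ : K.X k →ₗ[R] N) (hψ : ∀ i (w : K.X i), ψ (K.d i k w) = 0) :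
    ∃ (κ : LinearMap.ker (K.d k (c.next k)).hom →ₗ[R] K.homology k) (ρ : K.homology k →ₗ[R] N),
      (∀ x, (∃ j, ∃ w : K.X j, K.d j k w = x.1) → κ x = 0) ∧
        ∀ x, ρ (κ x) = ψ x := by
  let Z := LinearMap.ker (K.d k (c.next k)).hom
  let i : ModuleCat.of R Z ⟶ K.X k := ModuleCat.ofHom Z.subtype
  have hi : i ≫ K.d k (c.next k) = 0 := ModuleCat.hom_ext (LinearMap.ext fun x => x.2)
  let κ : ModuleCat.of R Z ⟶ K.homology k := K.liftCycles i _ rfl hi ≫ K.homologyπ k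
  let ρ : K.homology k ⟶ ModuleCat.of R N :=
    K.homologyι k ≫ K.descOpcycles (ModuleCat.ofHom ψ) (c.prev k) rfl
      (ModuleCat.hom_ext (LinearMap.ext fun w => hψ _ w))
  have hρ : κ ≫ ρ = i ≫ ModuleCat.ofHom ψ := by
    simp [κ, ρ]
  refine ⟨κ.hom, ρ.hom, ?_, fun x => congrArg (fun φ => φ.hom x) hρ⟩
  rintro x ⟨j, w, hw⟩
  have h1 : (ConcreteCategory.hom (K.liftCycles i _ rfl hi)) x = K.toCycles j k w := by
    apply (ModuleCat.mono_iff_injective (K.iCycles k)).1 inferInstance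
    rw [← ConcreteCategory.comp_apply, ← ConcreteCategory.comp_apply]
    simpa [i] using hw.symm
  have h2 : K.toCycles j k ≫ K.homologyπ k = 0 := K.toCycles_comp_homologyπ j k
  have h3 : K.homologyπ k (K.toCycles j k w) = 0 := congrArg (fun φ => φ.hom w) h2
  exact (congrArg (K.homologyπ k) h1).trans h3

/-- A group embeds in the homology of a complex as soon as it is represented by cycles which are
additive up to boundaries, and which are detected by a cocycle. -/
theorem exists_injective_to_homology {ι : Type*} {c : ComplexShape ι}
    (K : HomologicalComplex (ModuleCat.{0} ℤ) c) (k : ι) {B : Type} [AddCommGroup B]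
    (z : B → K.X k) (ψ : K.X k →ₗ[ℤ] B)
    (hz : ∀ j g, K.d k j (z g) = 0)
    (hadd : ∀ g h, ∃ i, ∃ w : K.X i, K.d i k w = z (g + h) - (z g + z h))
    (hψ : ∀ i (w : K.X i), ψ (K.d i k w) = 0)
    (hψz : ∀ g, ψ (z g) = g) :
    ∃ f : B →+ K.homology k, Function.Injective f := by
  obtain ⟨κ, ρ, hκ, hρ⟩ := exists_homology_maps K k ψ hψ
  let zz : B → LinearMap.ker (K.d k (c.next k)).hom := fun g => ⟨z g, hz _ g⟩
  have hsum : ∀ g h, κ (zz (g + h)) = κ (zz g) + κ (zz h) := by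
    intro g h
    rw [← sub_eq_zero, ← map_add, ← map_sub]
    exact hκ _ (hadd g h)
  refine ⟨AddMonoidHom.mk' (fun g => κ (zz g)) hsum, ?_⟩
  exact Function.LeftInverse.injective (g := fun y => ρ y) fun g => (hρ (zz g)).trans (hψz g)

/-! ### Differentials of single tuples and rank bounds on length -/

section Chains

variable {V : Type*} (G : SimpleGraph V)

open Classical in
/-- The chain of a tuple, zero unless the tuple is a generator. -/
def tupleChain {k : ℕ} (l : ℕ) (t : Fin (k + 1) → V) : EMC ℤ G k l :=
  if h : Function.Injective t ∧ len G t = (l : ℕ∞) then Finsupp.single ⟨t, h⟩ 1 else 0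

variable {G}

theorem tupleChain_val {k l : ℕ} (x : Generator G k l) :
    tupleChain G l x.1 = Finsupp.single x 1 := by
  rw [tupleChain, dif_pos x.2]

theorem d_single {k l : ℕ} (x : Generator G (k + 1) l) :
    d ℤ G k l (Finsupp.single x 1) =
      ∑ j : Fin k, (-1 : ℤ) ^ ((j : ℕ) + 1) • tupleChain G l (del j x.1) := by
  simp only [d, LinearMap.sum_apply, LinearMap.smul_apply, face,
    Finsupp.linearCombination_single, one_smul]
  refine Finset.sum_congr rfl fun j _ => ?_
  congr 1
  by_cases h : len G (del j x.1) = (l : ℕ∞)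
  · rw [faceGen, dif_pos h, tupleChain, dif_pos ⟨del_injective j x.2.1, h⟩]
  · rw [faceGen, dif_neg h, tupleChain, dif_neg fun h' => h h'.2]

theorem d_tupleChain {k l : ℕ} {t : Fin (k + 2) → V} (ht : Function.Injective t)
    (hl : len G t = (l : ℕ∞)) :
    d ℤ G k l (tupleChain G l t) =
      ∑ j : Fin k, (-1 : ℤ) ^ ((j : ℕ) + 1) • tupleChain G l (del j t) := by
  rw [← d_single ⟨t, ht, hl⟩, ← tupleChain_val]

theorem complex_d (G : SimpleGraph V) (k l : ℕ) (w : EMC ℤ G (k + 1) l) :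
    (complex ℤ G l).d (k + 1) k w = d ℤ G k l w := by
  have : (complex ℤ G l).d (k + 1) k = ModuleCat.ofHom (d ℤ G k l) :=
    ChainComplex.of_d (fun k => ModuleCat.of ℤ (EMC ℤ G k l))
      (fun k => ModuleCat.ofHom (d ℤ G k l)) k
  rw [this]
  rfl

theorem len_succ {k : ℕ} (t : Fin (k + 2) → V) :
    len G t = G.edist (t 0) (t 1) + len G (fun i => t i.succ) := by
  rw [len, Fin.sum_univ_succ]
  rfl

/-- Each edge of a shortest walk raises `r` by at most one. This bounds distances below without
computing them. -/
theorem rank_le_add_edist {r : V → ℕ} (hr : ∀ x y, G.Adj x y → r y ≤ r x + 1) (x y : V) :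
    (r y : ℕ∞) ≤ r x + G.edist x y := by
  by_cases h : G.edist x y = ⊤
  · simp [h]
  · obtain ⟨p, hp⟩ := SimpleGraph.exists_walk_of_edist_ne_top h
    rw [← hp]
    have key : r y ≤ r x + p.length := by
      clear hp h
      induction p with
      | nil => simp
      | cons h p ih =>
        have := hr _ _ h
        rw [SimpleGraph.Walk.length_cons]
        lia
    exact_mod_cast key

theorem rank_le_add_len {r : V → ℕ} (hr : ∀ x y, G.Adj x y → r y ≤ r x + 1) {k : ℕ}
    (t : Fin (k + 1) → V) : (r (t (Fin.last k)) : ℕ∞) ≤ r (t 0) + len G t := by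
  induction k with
  | zero => simp
  | succ k ih =>
    rw [len_succ, ← add_assoc]
    refine (ih fun i => t i.succ).trans ?_
    gcongr
    exact rank_le_add_edist hr _ _

end Chains

/-! ### Bidegree (0, 0) -/

theorem exists_injective_to_EMH_zero {V : Type} (G : SimpleGraph V) :
    ∃ f : (V →₀ ℤ) →+ EMH ℤ G 0 0, Function.Injective f := by
  let e : Generator G 0 0 ≃ V :=
    { toFun := fun x => x.1 0
      invFun := fun v => ⟨fun _ => v, fun i j _ => Subsingleton.elim (α := Fin 1) i j, by simp [len]⟩
      left_inv := fun x => by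
        ext i
        fin_cases i
        rfl
      right_inv := fun _ => rfl }
  let E : EMC ℤ G 0 0 ≃ₗ[ℤ] (V →₀ ℤ) := Finsupp.domLCongr e
  refine exists_injective_to_homology (complex ℤ G 0) 0 (fun v => E.symm v) E.toLinearMap
    ?_ ?_ ?_ ?_
  · intro j g
    rw [HomologicalComplex.shape _ _ _ (by simp)]
    rfl
  · intro g h
    refine ⟨0, 0, ?_⟩
    rw [map_zero, map_add]
    exact (sub_self _).symm
  · intro i w
    by_cases hi : i = 1
    · subst hi
      have h0 : (complex ℤ G 0).d 1 0 w = d ℤ G 0 0 w := complex_d G 0 0 w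
      -- A pair has no inner position, so the sum is empty.
      have h1 : d ℤ G 0 0 = 0 := by simp [d]
      rw [h0, h1]
      exact map_zero E
    · rw [HomologicalComplex.shape _ _ _ (by simpa using Ne.symm hi)]
      exact map_zero E
  · intro g
    exact E.apply_symm_apply g

/-! ### The poset of cells and its Hasse diagram -/

/-- The cells of the quotient of the join of three copies of a group `B` by the diagonal action of
`B`, with a bottom and a top element added. The edge `edge c g` is opposite to the vertex `pt c`;
a triangle is given by the labels of two of its edges, the three labels having sum zero. -/
inductive Cell (B : Type) : Type
  | bot : Cell B
  | pt (i : Fin 3) : Cell B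
  | edge (c : Fin 3) (g : B) : Cell B
  | tri (s : B × B) : Cell B
  | top : Cell B

namespace Cell

variable {B : Type}

/-- The rank of a cell. -/
def rank : Cell B → ℕ
  | bot => 0
  | pt _ => 1
  | edge _ _ => 2
  | tri _ => 3
  | top => 4

theorem del_zero_five (x y z : Cell B) :
    del (0 : Fin 3) ![bot, x, y, z, top] = ![bot, y, z, top] := by
  funext i
  fin_cases i <;> rfl

theorem del_one_five (x y z : Cell B) :
    del (1 : Fin 3) ![bot, x, y, z, top] = ![bot, x, z, top] := by
  funext i
  fin_cases i <;> rfl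

theorem del_two_five (x y z : Cell B) :
    del (2 : Fin 3) ![bot, x, y, z, top] = ![bot, x, y, top] := by
  funext i
  fin_cases i <;> rfl

theorem del_zero_four (x y : Cell B) : del (0 : Fin 2) ![bot, x, y, top] = ![bot, y, top] := by
  funext i
  fin_cases i <;> rfl

theorem del_one_four (x y : Cell B) : del (1 : Fin 2) ![bot, x, y, top] = ![bot, x, top] := by
  funext i
  fin_cases i <;> rfl

theorem injective_of_rank_lt {k : ℕ} {t : Fin (k + 1) → Cell B}
    (h : ∀ i : Fin k, rank (t i.castSucc) < rank (t i.succ)) : Function.Injective t :=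
  Function.Injective.of_comp (f := rank) (Fin.strictMono_iff_lt_succ.2 h).injective

instance [Finite B] : Finite (Cell B) := by
  let f : Cell B → Option (Option (Fin 3 ⊕ (Fin 3 × B) ⊕ (B × B))) := fun
    | bot => none
    | top => some none
    | pt i => some (some (Sum.inl i))
    | edge c g => some (some (Sum.inr (Sum.inl (c, g))))
    | tri s => some (some (Sum.inr (Sum.inr s)))
  refine Finite.of_injective f fun x y h => ?_
  cases x <;> cases y <;> simp_all [f]

variable [AddCommGroup B]

/-- The labels of the edges of a triangle. -/
def label (s : B × B) : Fin 3 → B := ![s.1, s.2, -(s.1 + s.2)]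

/-- The covering relation between cells. -/
def Covers : Cell B → Cell B → Prop
  | bot, pt _ => True
  | pt i, edge c _ => i ≠ c
  | edge c g, tri s => g = label s c
  | tri _, top => True
  | _, _ => False

theorem Covers.rank_eq {x y : Cell B} (h : Covers x y) : rank y = rank x + 1 := by
  cases x <;> cases y <;> simp_all [Covers, rank]

variable (B) in
/-- The Hasse diagram of the poset of cells. -/
def hasse : SimpleGraph (Cell B) := SimpleGraph.fromRel Covers

theorem Covers.adj {x y : Cell B} (h : Covers x y) : (hasse B).Adj x y := by
  refine (SimpleGraph.fromRel_adj _ _ _).2 ⟨?_, Or.inl h⟩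
  rintro rfl
  have := h.rank_eq
  lia

theorem covers_of_adj {x y : Cell B} (h : (hasse B).Adj x y) (hr : rank x ≤ rank y) :
    Covers x y := by
  rcases ((SimpleGraph.fromRel_adj _ _ _).1 h).2 with h | h
  · exact h
  · have := h.rank_eq
    lia

theorem rank_le_of_adj (x y : Cell B) (h : (hasse B).Adj x y) : rank y ≤ rank x + 1 := by
  rcases ((SimpleGraph.fromRel_adj _ _ _).1 h).2 with h | h <;> have := h.rank_eq <;> lia

theorem hasse_connected : (hasse B).Connected := by
  have hpt : ∀ i, (hasse B).Reachable bot (pt i) := fun i =>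
    (Covers.adj (x := bot) (y := pt i) trivial).reachable
  have hedge : ∀ c g, (hasse B).Reachable bot (edge c g) := fun c g =>
    (hpt (c + 1)).trans (Covers.adj (x := pt (c + 1)) (y := edge c g) (by
      simp [Covers])).reachable
  have htri : ∀ s, (hasse B).Reachable bot (tri s) := fun s =>
    (hedge 0 s.1).trans (Covers.adj (x := edge 0 s.1) (y := tri s) rfl).reachable
  have htop : (hasse B).Reachable bot top :=
    (htri 0).trans (Covers.adj (x := tri 0) (y := top) trivial).reachable
  have hall : ∀ x, (hasse B).Reachable bot x
    | bot => SimpleGraph.Reachable.refl _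
    | pt i => hpt i
    | edge c g => hedge c g
    | tri s => htri s
    | top => htop
  exact { preconnected := fun x y => (hall x).symm.trans (hall y), nonempty := ⟨bot⟩ }

/-! ### The detecting cocycle -/

/-- A cocycle with values in `B` on the pairs of comparable cells. -/
def cocycle : Cell B → Cell B → B
  | pt i, edge c g => if i = c + 1 then g else 0
  | edge c _, tri s => ![0, -s.2, s.1] c
  | pt i, tri s => ![-s.2, s.1, 0] i
  | _, _ => 0

/-- The covers force a flag vertex < edge < triangle. Each of the six flags of a triangle is
checked, using that its labels sum to zero. -/
theorem cocycle_add {x y z : Cell B} (h0 : Covers bot x) (h1 : Covers x y) (h2 : Covers y z) :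
    cocycle x y + cocycle y z = cocycle x z := by
  rcases x with _ | i | _ | _ | _ <;> try exact h0.elim
  rcases y with _ | _ | ⟨c, g⟩ | _ | _ <;> try exact h1.elim
  rcases z with _ | _ | _ | s | _ <;> try exact h2.elim
  have h1' : i ≠ c := h1
  have h2' : g = label s c := h2
  subst h2'
  fin_cases i <;> fin_cases c <;> simp_all [cocycle, label]

open Classical in
/-- The cocycle, on tuples from the bottom to the top. -/
def tupleCocycle (t : Fin 4 → Cell B) : B :=
  if t 0 = bot ∧ t 3 = top then cocycle (t 1) (t 2) else 0

variable (B) in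
/-- The cocycle, on chains. -/
def chainCocycle : EMC ℤ (hasse B) 3 4 →ₗ[ℤ] B :=
  Finsupp.linearCombination ℤ fun x => tupleCocycle x.1

theorem chainCocycle_tupleChain {t : Fin 4 → Cell B} (ht : Function.Injective t)
    (hl : len (hasse B) t = (4 : ℕ)) :
    chainCocycle B (tupleChain (hasse B) 4 t) = tupleCocycle t := by
  rw [tupleChain, dif_pos ⟨ht, hl⟩, chainCocycle, Finsupp.linearCombination_single, one_smul]

/-- Faces keep the end points, so a cochain may be supported on a single pair of ends. -/
theorem chainCocycle_tupleChain_of_ends {t : Fin 4 → Cell B} (ht : ¬ (t 0 = bot ∧ t 3 = top)) :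
    chainCocycle B (tupleChain (hasse B) 4 t) = 0 := by
  by_cases h : Function.Injective t ∧ len (hasse B) t = (4 : ℕ)
  · rw [chainCocycle_tupleChain h.1 h.2, tupleCocycle, if_neg ht]
  · rw [tupleChain, dif_neg h, map_zero]

theorem four_le_len {k : ℕ} {t : Fin (k + 1) → Cell B} (h0 : t 0 = bot)
    (h1 : t (Fin.last k) = top) : ((4 : ℕ) : ℕ∞) ≤ len (hasse B) t := by
  have := rank_le_add_len (G := hasse B) rank_le_of_adj t
  rw [h0, h1] at this
  simpa [rank] using this

/-- Deleting an entry of a geodesic tuple from the bottom to the top preserves its length. -/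
theorem len_del_eq {k : ℕ} (j : Fin k) {t : Fin (k + 2) → Cell B} (h0 : t 0 = bot)
    (h1 : t (Fin.last (k + 1)) = top) (hl : len (hasse B) t = (4 : ℕ)) :
    len (hasse B) (del j t) = (4 : ℕ) := by
  refine le_antisymm ((len_del_le _ j t).trans_eq hl) (four_le_len ?_ ?_)
  · rw [← h0, del]
    congr 1
  · rw [← h1, del]
    congr 1
    ext
    simp only [val_succAbove, val_innerPos, Fin.val_last]
    grind

/-- Four steps of length at least 1 total 4, so each is an edge; the rank must climb from 0 to 4, so
each edge goes up. -/
theorem covers_of_geodesic {t : Fin 5 → Cell B} (ht : Function.Injective t)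
    (hl : len (hasse B) t = (4 : ℕ)) (h0 : t 0 = bot) (h4 : t 4 = top) :
    Covers (t 0) (t 1) ∧ Covers (t 1) (t 2) ∧ Covers (t 2) (t 3) := by
  have hsum : len (hasse B) t = (hasse B).edist (t 0) (t 1) + (hasse B).edist (t 1) (t 2) +
      (hasse B).edist (t 2) (t 3) + (hasse B).edist (t 3) (t 4) := by
    rw [len, Fin.sum_univ_four]
    rfl
  rw [hl] at hsum
  have hpos : ∀ i j : Fin 5, i ≠ j → 1 ≤ (hasse B).edist (t i) (t j) := fun i j hij =>
    Order.one_le_iff_pos.2 (SimpleGraph.edist_pos_of_ne (ht.ne hij))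
  have p0 := hpos 0 1 (by decide)
  have p1 := hpos 1 2 (by decide)
  have p2 := hpos 2 3 (by decide)
  have p3 := hpos 3 4 (by decide)
  have key : ∀ a b c e : ℕ∞, ((4 : ℕ) : ℕ∞) = a + b + c + e → 1 ≤ a → 1 ≤ b → 1 ≤ c → 1 ≤ e →
      a = 1 ∧ b = 1 ∧ c = 1 ∧ e = 1 := by
    intro a b c e h ha hb hc he
    cases a <;> cases b <;> cases c <;> cases e <;> norm_cast at *; lia
  obtain ⟨e0, e1, e2, e3⟩ := key _ _ _ _ hsum p0 p1 p2 p3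
  rw [SimpleGraph.edist_eq_one_iff_adj] at e0 e1 e2 e3
  have r0 := rank_le_of_adj _ _ e0
  have r1 := rank_le_of_adj _ _ e1
  have r2 := rank_le_of_adj _ _ e2
  have r3 := rank_le_of_adj _ _ e3
  have rb : rank (t 0) = 0 := by rw [h0]; rfl
  have rt : rank (t 4) = 4 := by rw [h4]; rfl
  exact ⟨covers_of_adj e0 (by lia), covers_of_adj e1 (by lia), covers_of_adj e2 (by lia)⟩

theorem chainCocycle_d (w : EMC ℤ (hasse B) 4 4) : chainCocycle B (d ℤ (hasse B) 3 4 w) = 0 := by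
  suffices h : chainCocycle B ∘ₗ d ℤ (hasse B) 3 4 = 0 from LinearMap.congr_fun h w
  refine Finsupp.lhom_ext' fun x => LinearMap.ext_ring ?_
  obtain ⟨t, ht, hl⟩ := x
  simp only [LinearMap.comp_apply, Finsupp.lsingle_apply, LinearMap.zero_apply, d_single,
    map_sum, map_smul]
  have e0 : ∀ j : Fin 3, del j t 0 = t 0 := fun j => by fin_cases j <;> rfl
  have e3 : ∀ j : Fin 3, del j t 3 = t 4 := fun j => by fin_cases j <;> rfl
  by_cases hends : t 0 = bot ∧ t 4 = top
  · obtain ⟨c0, c1, c2⟩ := covers_of_geodesic ht hl hends.1 hends.2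
    have hj : ∀ j : Fin 3, chainCocycle B (tupleChain (hasse B) 4 (del j t)) =
        cocycle (del j t 1) (del j t 2) := fun j => by
      rw [chainCocycle_tupleChain (del_injective j ht) (len_del_eq j hends.1 hends.2 hl),
        tupleCocycle, if_pos ⟨(e0 j).trans hends.1, (e3 j).trans hends.2⟩]
    rw [hends.1] at c0
    have hc := cocycle_add c0 c1 c2
    have q0 : cocycle (del (0 : Fin 3) t 1) (del (0 : Fin 3) t 2) = cocycle (t 2) (t 3) := rfl
    have q1 : cocycle (del (1 : Fin 3) t 1) (del (1 : Fin 3) t 2) = cocycle (t 1) (t 3) := rfl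
    have q2 : cocycle (del (2 : Fin 3) t 1) (del (2 : Fin 3) t 2) = cocycle (t 1) (t 2) := rfl
    -- All three faces survive, with signs -, +, -, so the sum vanishes by the cocycle identity.
    rw [Fin.sum_univ_three, hj, hj, hj, q0, q1, q2, ← hc]
    simp
  · refine Finset.sum_eq_zero fun j _ => ?_
    rw [chainCocycle_tupleChain_of_ends (by rwa [e0, e3]), smul_zero]

/-! ### Loops and the relations given by triangles -/

theorem geodesic_of_covers {x y z : Cell B} (h0 : Covers bot x) (h1 : Covers x y)
    (h2 : Covers y z) (h3 : Covers z top) :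
    Function.Injective ![bot, x, y, z, top] ∧
      len (hasse B) ![bot, x, y, z, top] = (4 : ℕ) := by
  constructor
  · refine injective_of_rank_lt fun i => ?_
    have := h0.rank_eq
    have := h1.rank_eq
    have := h2.rank_eq
    have := h3.rank_eq
    fin_cases i <;> simp <;> lia
  · rw [len, Fin.sum_univ_four]
    have e0 := SimpleGraph.edist_eq_one_iff_adj.2 h0.adj
    have e1 := SimpleGraph.edist_eq_one_iff_adj.2 h1.adj
    have e2 := SimpleGraph.edist_eq_one_iff_adj.2 h2.adj
    have e3 := SimpleGraph.edist_eq_one_iff_adj.2 h3.adj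
    change (hasse B).edist bot x + (hasse B).edist x y + (hasse B).edist y z +
      (hasse B).edist z top = _
    rw [e0, e1, e2, e3]
    norm_num

/-- The chain of a pair of cells, as a tuple from the bottom to the top. -/
def pairChain (x y : Cell B) : EMC ℤ (hasse B) 3 4 := tupleChain (hasse B) 4 ![bot, x, y, top]

theorem pairChain_add_sub_mem {x y z : Cell B} (h0 : Covers bot x) (h1 : Covers x y)
    (h2 : Covers y z) (h3 : Covers z top) :
    pairChain x y + pairChain y z - pairChain x z ∈ LinearMap.range (d ℤ (hasse B) 3 4) := by
  obtain ⟨hi, hl⟩ := geodesic_of_covers h0 h1 h2 h3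
  -- Inner positions start at 1, so the faces carry the signs -, +, -; negation corrects this.
  refine ⟨-tupleChain (hasse B) 4 ![bot, x, y, z, top], ?_⟩
  rw [map_neg, d_tupleChain hi hl, Fin.sum_univ_three, del_zero_five, del_one_five, del_two_five]
  simp [pairChain]
  abel

theorem exists_tri (c : Fin 3) (g : B) : ∃ s : B × B, g = label s c := by
  fin_cases c
  · exact ⟨(g, 0), rfl⟩
  · exact ⟨(0, g), rfl⟩
  · exact ⟨(-g, 0), by simp [label]⟩

/-- Every edge lies in a triangle, so the tuple is a face of a maximal geodesic. -/
theorem pt_edge_geodesic {i c : Fin 3} (hic : i ≠ c) (g : B) :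
    Function.Injective ![bot, pt i, edge c g, top] ∧
      len (hasse B) ![bot, pt i, edge c g, top] = (4 : ℕ) := by
  obtain ⟨s, hs⟩ := exists_tri c g
  obtain ⟨hi, hl⟩ := geodesic_of_covers (x := pt i) (y := edge c g) (z := tri s)
    trivial hic hs trivial
  rw [← del_two_five (pt i) (edge c g) (tri s)]
  exact ⟨del_injective _ hi, len_del_eq _ rfl rfl hl⟩

/-- The chain of an edge, as the path between its end points. -/
def edgeChain (c : Fin 3) (g : B) : EMC ℤ (hasse B) 3 4 :=
  pairChain (pt (c + 1)) (edge c g) - pairChain (pt (c + 2)) (edge c g)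

/-- The two terms through the edge cancel. The result does not depend on `g`: edges with equal `c`
are parallel. -/
theorem d_edgeChain (c : Fin 3) (g : B) :
    d ℤ (hasse B) 2 4 (edgeChain c g) =
      tupleChain (hasse B) 4 ![bot, pt (c + 1), top] -
        tupleChain (hasse B) 4 ![bot, pt (c + 2), top] := by
  obtain ⟨hi1, hl1⟩ := pt_edge_geodesic (i := c + 1) (c := c) (by simp) g
  obtain ⟨hi2, hl2⟩ := pt_edge_geodesic (i := c + 2) (c := c) (by simp) g
  rw [edgeChain, map_sub, pairChain, pairChain, d_tupleChain hi1 hl1, d_tupleChain hi2 hl2,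
    Fin.sum_univ_two, Fin.sum_univ_two, del_zero_four, del_one_four, del_zero_four, del_one_four]
  simp

/-- The boundary of a triangle is a boundary. -/
theorem edgeChain_add_mem (s : B × B) :
    edgeChain 0 s.1 + edgeChain 1 s.2 + edgeChain 2 (-(s.1 + s.2)) ∈
      LinearMap.range (d ℤ (hasse B) 3 4) := by
  have key : ∀ i c : Fin 3, i ≠ c → pairChain (pt i) (edge c (label s c)) +
      pairChain (edge c (label s c)) (tri s) - pairChain (pt i) (tri s) ∈
        LinearMap.range (d ℤ (hasse B) 3 4) := fun i c hic =>
    pairChain_add_sub_mem (x := pt i) (y := edge c (label s c)) (z := tri s)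
      trivial hic rfl trivial
  -- Subtracting the two flags through one edge cancels the edge-triangle terms. Summed over `c`,
  -- the vertex-triangle terms cancel cyclically.
  have hdiff : ∀ c : Fin 3, edgeChain c (label s c) -
      (pairChain (pt (c + 1)) (tri s) - pairChain (pt (c + 2)) (tri s)) ∈
        LinearMap.range (d ℤ (hasse B) 3 4) := fun c => by
    have := sub_mem (key (c + 1) c (by simp)) (key (c + 2) c (by simp))
    convert this using 1
    rw [edgeChain]
    abel
  have := add_mem (add_mem (hdiff 0) (hdiff 1)) (hdiff 2)
  convert this using 1
  have a1 : (1 : Fin 3) + 1 = 2 := rfl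
  have a2 : (1 : Fin 3) + 2 = 0 := rfl
  have a3 : (2 : Fin 3) + 1 = 0 := rfl
  have a4 : (2 : Fin 3) + 2 = 1 := rfl
  have l0 : label s 0 = s.1 := rfl
  have l1 : label s 1 = s.2 := rfl
  have l2 : label s 2 = -(s.1 + s.2) := rfl
  rw [a1, a2, a3, a4, l0, l1, l2, zero_add, zero_add]
  abel

/-- The loop formed by two parallel edges. -/
def loopChain (g : B) : EMC ℤ (hasse B) 3 4 := edgeChain 2 g - edgeChain 2 0

theorem d_loopChain (g : B) : d ℤ (hasse B) 2 4 (loopChain g) = 0 := by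
  rw [loopChain, map_sub, d_edgeChain, d_edgeChain, sub_self]

theorem loopChain_add_mem (g h : B) :
    loopChain (g + h) - (loopChain g + loopChain h) ∈ LinearMap.range (d ℤ (hasse B) 3 4) := by
  -- The four triangles are chosen so that in r3 + r4 - r1 - r2 the edges with `c = 0` and `c = 1`
  -- cancel.
  have r1 := edgeChain_add_mem ((0, -g) : B × B)
  have r2 := edgeChain_add_mem ((g, -(g + h)) : B × B)
  have r3 := edgeChain_add_mem ((0, -(g + h)) : B × B)
  have r4 := edgeChain_add_mem ((g, -g) : B × B)
  have := sub_mem (add_mem r3 r4) (add_mem r1 r2)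
  have n1 : -((0 : B) + -g) = g := by abel
  have n2 : -(g + -(g + h)) = h := by abel
  have n3 : -((0 : B) + -(g + h)) = g + h := by abel
  have n4 : -(g + -g) = 0 := by abel
  simp only [n1, n2, n3, n4] at this
  convert this using 1
  simp only [loopChain]
  abel

theorem chainCocycle_edgeChain (g : B) : chainCocycle B (edgeChain 2 g) = g := by
  obtain ⟨hi1, hl1⟩ := pt_edge_geodesic (i := 2 + 1) (c := 2) (by simp) g
  obtain ⟨hi2, hl2⟩ := pt_edge_geodesic (i := 2 + 2) (c := 2) (by simp) g
  rw [edgeChain, map_sub, pairChain, pairChain, chainCocycle_tupleChain hi1 hl1,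
    chainCocycle_tupleChain hi2 hl2]
  simp [tupleCocycle, cocycle]

theorem exists_injective_to_EMH_three :
    ∃ f : B →+ EMH ℤ (hasse B) 3 4, Function.Injective f := by
  refine exists_injective_to_homology (complex ℤ (hasse B) 4) 3 loopChain (chainCocycle B)
    ?_ ?_ ?_ ?_
  · intro j g
    by_cases hj : j = 2
    · subst hj
      exact (complex_d (hasse B) 2 4 (loopChain g)).trans (d_loopChain g)
    · rw [HomologicalComplex.shape _ _ _ (by
        rw [ComplexShape.down_Rel]
        lia)]
      rfl
  · intro g h
    obtain ⟨w, hw⟩ := loopChain_add_mem g h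
    exact ⟨4, w, (complex_d (hasse B) 3 4 w).trans hw⟩
  · intro i w
    by_cases hi : i = 4
    · subst hi
      have h0 : (complex ℤ (hasse B) 4).d 4 3 w = d ℤ (hasse B) 3 4 w := complex_d (hasse B) 3 4 w
      rw [h0]
      exact chainCocycle_d w
    · rw [HomologicalComplex.shape _ _ _ (by
        rw [ComplexShape.down_Rel]
        lia)]
      exact map_zero (chainCocycle B)
  · intro g
    refine (map_sub (chainCocycle B) _ _).trans ?_
    rw [chainCocycle_edgeChain, chainCocycle_edgeChain, sub_zero]

/-! ### Assembling the two bidegrees -/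

theorem exists_injective_to_TotalEMH :
    ∃ f : (Cell B →₀ ℤ) × B →+ TotalEMH ℤ (hasse B), Function.Injective f := by
  classical
  obtain ⟨f, hf⟩ := exists_injective_to_EMH_zero (hasse B)
  obtain ⟨g, hg⟩ := exists_injective_to_EMH_three (B := B)
  let ι (p : ℕ × ℕ) : EMH ℤ (hasse B) p.1 p.2 →+ TotalEMH ℤ (hasse B) :=
    DirectSum.of (fun p : ℕ × ℕ => EMH ℤ (hasse B) p.1 p.2) p
  refine ⟨((ι (0, 0)).comp f).coprod ((ι (3, 4)).comp g), ?_⟩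
  rw [injective_iff_map_eq_zero]
  rintro ⟨a, b⟩ hab
  have hab' : ι (0, 0) (f a) + ι (3, 4) (g b) = 0 := hab
  have h1 := DFunLike.congr_fun hab' (0, 0)
  have h2 := DFunLike.congr_fun hab' (3, 4)
  rw [DirectSum.add_apply, DirectSum.of_eq_same, DirectSum.of_eq_of_ne _ _ _ (by simp),
    DirectSum.zero_apply, add_zero] at h1
  rw [DirectSum.add_apply, DirectSum.of_eq_same, DirectSum.of_eq_of_ne _ _ _ (by simp),
    DirectSum.zero_apply, zero_add] at h2
  exact Prod.ext ((injective_iff_map_eq_zero f).1 hf a h1)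
    ((injective_iff_map_eq_zero g).1 hg b h2)

end Cell

end EulerianMagnitude

end

open EulerianMagnitude DirectSum in
theorem exists_finite_addCommGroup_embedding (A : Type*) [AddCommGroup A] [AddGroup.FG A] :
    ∃ (B : Type) (_ : AddCommGroup B) (_ : Finite B) (f : A →+ (Cell B →₀ ℤ) × B),
      Function.Injective f := by
  obtain ⟨n, ι, _, p, hp, e, ⟨φ⟩⟩ := AddCommGroup.equiv_free_prod_directSum_zmod A
  have : ∀ i, NeZero (p i ^ e i) := fun i => ⟨pow_ne_zero _ (hp i).ne_zero⟩
  have hfin : Finite (⨁ i : ι, ZMod (p i ^ e i)) :=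
    Finite.of_injective (fun x i => x i) DFunLike.coe_injective
  let T := ⨁ i : ι, ZMod (p i ^ e i)
  -- The cyclic factor only supplies `n` distinct vertices for the free part; `n + 1` keeps it
  -- finite when `n = 0`.
  let B := T × ZMod (n + 1)
  let v : Fin n → Cell B := fun i => Cell.edge 0 (0, ((i : ℕ) : ZMod (n + 1)))
  have hv : Function.Injective v := by
    intro i j hij
    have h1 : ((i : ℕ) : ZMod (n + 1)) = ((j : ℕ) : ZMod (n + 1)) := by
      exact congrArg Prod.snd (Cell.edge.inj hij).2
    rw [ZMod.natCast_eq_natCast_iff', Nat.mod_eq_of_lt (by lia), Nat.mod_eq_of_lt (by lia)] at h1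
    exact Fin.ext h1
  let f : (Fin n →₀ ℤ) × T →+ (Cell B →₀ ℤ) × B :=
    (Finsupp.mapDomain.addMonoidHom v).prodMap (AddMonoidHom.inl T (ZMod (n + 1)))
  have hl : Function.Injective (AddMonoidHom.inl T (ZMod (n + 1))) := fun x y h =>
    congrArg Prod.fst h
  have hf : Function.Injective f := (Finsupp.mapDomain_injective hv).prodMap hl
  exact ⟨B, inferInstance, inferInstance, f.comp φ.toAddMonoidHom, hf.comp φ.injective⟩

theorem mainTheorem9 (A : Type*) [AddCommGroup A] [AddGroup.FG A] :
    ∃ (V : Type) (_ : Finite V) (G : SimpleGraph V), G.Connected ∧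
      ∃ H : AddSubgroup (EulerianMagnitude.TotalEMH ℤ G), Nonempty (A ≃+ H) := by
  obtain ⟨B, _, _, f, hf⟩ := exists_finite_addCommGroup_embedding A
  obtain ⟨g, hg⟩ := EulerianMagnitude.Cell.exists_injective_to_TotalEMH (B := B)
  exact ⟨EulerianMagnitude.Cell B, inferInstance, EulerianMagnitude.Cell.hasse B,
    EulerianMagnitude.Cell.hasse_connected, (g.comp f).range,
    ⟨AddMonoidHom.ofInjective (f := g.comp f) (hg.comp hf)⟩⟩
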